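/- **Setting.** Let $N,M\in\mathbb Z_+$, let $\nu_1,\dots,\nu_M\in\mathbb Z^N$ be stoichiometric vectors and $a_1,\dots,a_M:\mathbb Z^N\to[0,\infty)$ propensity functions; put $a_0=\sum_j a_j$ and $\nu k=\sum_j k_j\nu_j$ for $k\in\mathbb Z_+^M$. Let $X$ be the associated chemical process, i.e. the $\mathbb Z^N$-valued right-continuous pure jump Markov process which, in a state $y$, waits an exponential time of rate $a_0(y)$ and then, independently of this time, fires reaction $j$ (moves to $y+\nu_j$) with probability $a_j(y)/a_0(y)$ (and stays in $y$ forever if $a_0(y)=0$). Assume that $X$ is non-explosive from every initial state, and let $P(\tau,x,x')=\mathrm{Prob}\{X(\tau)=x'\mid X(0)=x\}$, $\tau\ge0$. Let a tau leap method be given by probability mass functions $\tilde\phi(\tau,x;\cdot)$ on $\mathbb Z_+^M$ ($\tau\ge 0$, $x\in\mathbb Z^N$), and let $$\phi(\tau,x,x')=\sum_{k\in S(x,x')}\tilde\phi(\tau,x;k),\qquad S(x,x')=\{k\in\mathbb Z_+^M: x'-x=\nu k\}.$$ For $x\in\mathbb Z^N$ let $\tilde Q(x;\cdot,\cdot)$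 be the infinite matrix on $\mathbb Z_+^M$ with $\tilde Q(x;k',k)=a_j(x+\nu k')$ if $k=k'+e_j$, $\tilde Q(x;k',k)=-a_0(x+\nu k')$ if $k=k'$, and $0$ otherwise ($e_j$ the $j$th unit vector), and let $\tilde Q^i(x;\cdot,\cdot)$ be its $i$th matrix power. A superscript $(i)$ denotes the $i$th derivative in $\tau$ (one-sided at end points), and $|\cdot|$ denotes a fixed norm on $\mathbb R^N$, respectively on $\mathbb R^M$. **Theorem.** Let $q\in\mathbb Z_+$ and $\delta>0$, and suppose: 1. for all $x,k$ the function $\tau\mapsto\tilde\phi(\tau,x;k)$ is $q+1$ times continuously differentiable on $[0,\delta]$, and there are $\mu_{k,i}(x)$ with $|\tilde\phi^{(i)}(\tau,x;k)|\le\mu_{k,i}(x)$ for all $\tau\in[0,\delta]$, $x$, $k$ and $i=0,\dots,q+1$, such that for all $r\in\mathbb Z_+$ and $i=0,\dots,q+1$ there are constants $\eta_{r,i}$ and $\sigma_{r,i}\ge0$ with $\sum_{k}|k|^r\mu_{k,i}(x)\le\eta_{r,i}(1+|x|^{\sigma_{r,i}})$ for all $x\in\mathbb Z^N$ (where $|k|^0=1$);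 2. there is $s^*\in\mathbb Z_+$ such that for every $j$ there is $\alpha>0$ with $|a_j(x)|\le\alpha(|x|^{s^*}+1)$ for all $x\in\mathbb Z^N$; 3. $\tilde\phi^{(i)}(0,x;k)=\tilde Q^i(x;0,k)$ for all $x\in\mathbb Z^N$, $k\in\mathbb Z_+^M$ and $i=1,\dots,q$. Then $\phi$ is pointwise consistent of order $q$ with $P$: for all $x,x'\in\mathbb Z^N$ the function $\tau\mapsto\phi(\tau,x,x')$ is $q+1$ times continuously differentiable on $[0,\delta]$, $\tau\mapsto P(\tau,x,x')$ is infinitely differentiable on $[0,\infty)$, and $$\phi^{(i)}(0,x,x')=P^{(i)}(0,x,x'),\qquad i=1,\dots,q.$$ -/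

import Mathlib

open MeasureTheory Set
open scoped ENNReal

noncomputable section

/-- `N` species and `M` reaction channels: the stoichiometric vectors `ν_j ∈ ℤ^N` and the
propensity functions `a_j` on `ℤ^N`, which are jump rates and hence nonnegative. -/
structure ReactionNetwork (N M : ℕ) where
  ν : Fin M → (Fin N → ℤ)
  a : Fin M → (Fin N → ℤ) → ℝ
  a_nonneg : ∀ j x, 0 ≤ a j x

namespace ReactionNetwork

variable {N M : ℕ}

/-- The total propensity `a₀(x) = ∑ⱼ aⱼ(x)`. -/
def a₀ (net : ReactionNetwork N M) (x : Fin N → ℤ) : ℝ := ∑ j, net.a j x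

/-- The state `x + ν k` reached from `x` after the reaction counts `k ∈ ℤ₊^M`. -/
def shift (net : ReactionNetwork N M) (x : Fin N → ℤ) (k : Fin M → ℕ) : Fin N → ℤ :=
  x + ∑ j, k j • net.ν j

/-- The state after the first `n` of the channels listed in `c` have fired, started at `x`;
`none` means that no reaction fires. -/
def chain (net : ReactionNetwork N M) (x : Fin N → ℤ) (c : ℕ → Option (Fin M)) (n : ℕ) :
    Fin N → ℤ :=
  x + ∑ i ∈ Finset.range n, (c i).elim 0 net.ν

/-- The probability that the next channel to fire in the state `y` is `j`, namely `aⱼ(y) / a₀(y)`;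
if `a₀(y) = 0`, then with probability one no further channel fires (`none`). -/
def jumpProb (net : ReactionNetwork N M) (y : Fin N → ℤ) : Option (Fin M) → ℝ
  | some j => if net.a₀ y = 0 then 0 else net.a j y / net.a₀ y
  | none => if net.a₀ y = 0 then 1 else 0

/-- The infinite matrix `Q̃(x; k', k)` on `ℤ₊^M`: it equals `aⱼ(x + ν k')` if `k = k' + eⱼ`,
`-a₀(x + ν k')` if `k = k'`, and `0` otherwise. -/
def Qtilde (net : ReactionNetwork N M) (x : Fin N → ℤ) (k' k : Fin M → ℕ) : ℝ :=
  (∑ j, if k = k' + Pi.single j 1 then net.a j (net.shift x k') else 0) -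
    if k = k' then net.a₀ (net.shift x k') else 0

/-- The set `S(x, x')` of the reaction counts which take the system from `x` to `x'`. -/
def countSet (net : ReactionNetwork N M) (x x' : Fin N → ℤ) : Set (Fin M → ℕ) :=
  {k | x' = net.shift x k}

end ReactionNetwork

/-- Powers of an infinite matrix, with the product `(A B)(k, l) = ∑ₘ A(m, l) B(k, m)`. -/
def matPow {ι : Type*} [DecidableEq ι] (A : ι → ι → ℝ) : ℕ → ι → ι → ℝ
  | 0 => fun k l => if k = l then 1 else 0
  | n + 1 => fun k l => ∑' m, A m l * matPow A n k m

/-- The (non-explosive) chemical process of the network `net` started at the state `x`, on the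
measurable space `Ω`, given by its probability measure, its successive waiting times
`S 0, S 1, …` and the successive reaction channels `J 0, J 1, …` that fire.

While the process is in a state `y`, the waiting time for the next reaction is exponential with
rate `a₀(y)` and, independently, the next channel to fire is `j` with probability `aⱼ(y) / a₀(y)`;
given the present state, both are independent of the past. Written out for the first `n` channels
and the first `n + 1` waiting times this is the field `law`, where `net.chain x c i` is the state
reached after `i` reactions. In a state `y` with `a₀(y) = 0` the waiting time is infinite and no
further channel fires (`J = none`). -/
structure ChemicalProcess {N M : ℕ} (net : ReactionNetwork N M) (x : Fin N → ℤ)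
    (Ω : Type*) [MeasurableSpace Ω] where
  prob : Measure Ω
  isProb : IsProbabilityMeasure prob
  S : ℕ → Ω → ℝ≥0∞
  J : ℕ → Ω → Option (Fin M)
  measurable_S : ∀ n, Measurable (S n)
  measurableSet_J : ∀ n (c : Option (Fin M)), MeasurableSet {ω | J n ω = c}
  law : ∀ (n : ℕ) (c : ℕ → Option (Fin M)) (s : ℕ → ℝ), (∀ i, 0 ≤ s i) →
    prob {ω | (∀ i < n, J i ω = c i) ∧ ∀ i ≤ n, ENNReal.ofReal (s i) < S i ω} =
      ENNReal.ofReal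
        ((∏ i ∈ Finset.range n, net.jumpProb (net.chain x c i) (c i)) *
          ∏ i ∈ Finset.range (n + 1), Real.exp (-(net.a₀ (net.chain x c i) * s i)))
  nonexplosive : ∀ᵐ ω ∂prob, ∑' n, S n ω = ∞

namespace ChemicalProcess

variable {N M : ℕ} {net : ReactionNetwork N M} {x : Fin N → ℤ} {Ω : Type*} [MeasurableSpace Ω]

/-- The time of the `n`th reaction (and `0` for `n = 0`). -/
def jumpTime (X : ChemicalProcess net x Ω) (n : ℕ) (ω : Ω) : ℝ≥0∞ :=
  ∑ i ∈ Finset.range n, X.S i ω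

/-- The number of reactions fired during `(0, t]`: the `n` with
`jumpTime n ≤ t < jumpTime (n + 1)`. -/
def numJumps (X : ChemicalProcess net x Ω) (t : ℝ) (ω : Ω) : ℕ :=
  sInf {n | ENNReal.ofReal t < X.jumpTime (n + 1) ω}

/-- The state `X(t)`; the paths are right continuous step functions. -/
def state (X : ChemicalProcess net x Ω) (t : ℝ) (ω : Ω) : Fin N → ℤ :=
  net.chain x (fun i => X.J i ω) (X.numJumps t ω)

end ChemicalProcess

/-- The transition probabilities `P(τ, x, x') = Prob{X(τ) = x' | X(0) = x}` of the chemical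
process, given by its versions started at the various states `x`. -/
def transProb {N M : ℕ} {net : ReactionNetwork N M} {Ω : (Fin N → ℤ) → Type*}
    [∀ x, MeasurableSpace (Ω x)] (X : ∀ x, ChemicalProcess net x (Ω x))
    (τ : ℝ) (x x' : Fin N → ℤ) : ℝ :=
  (X x).prob.real {ω | (X x).state τ ω = x'}

/-- The conditional distributions `φ̃(τ, x; ·)` of the reaction counts `K ∈ ℤ₊^M` which a tau leap
method uses for a step of size `τ` from the state `x`. -/
structure TauLeapMethod (N M : ℕ) where
  φt : ℝ → (Fin N → ℤ) → (Fin M → ℕ) → ℝ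
  nonneg : ∀ τ, 0 ≤ τ → ∀ x k, 0 ≤ φt τ x k
  hasSum : ∀ τ, 0 ≤ τ → ∀ x, HasSum (φt τ x) 1

/-- The transition function `φ(τ, x, x') = ∑_{k ∈ S(x, x')} φ̃(τ, x; k)` of the tau leap method. -/
def TauLeapMethod.φ {N M : ℕ} (L : TauLeapMethod N M) (net : ReactionNetwork N M)
    (τ : ℝ) (x x' : Fin N → ℤ) : ℝ :=
  ∑' k : net.countSet x x', L.φt τ x k

/-- The class `C_r` of functions on `ℤ^N` of polynomial growth of degree `r`. -/
def PolyGrowth {N : ℕ} (nrm : Seminorm ℝ (Fin N → ℝ)) (r : ℕ) (f : (Fin N → ℤ) → ℝ) : Prop :=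
  ∃ α > 0, ∀ x : Fin N → ℤ, |f x| ≤ α * (nrm (fun i => (x i : ℝ)) ^ r + 1)

/-- The derivative bounds on `φ̃` over the interval `[0, δ]`. -/
structure DerivBounds {N M : ℕ} (nrmN : Seminorm ℝ (Fin N → ℝ)) (nrmM : Seminorm ℝ (Fin M → ℝ))
    (q : ℕ) (δ : ℝ) (φt : ℝ → (Fin N → ℤ) → (Fin M → ℕ) → ℝ) : Prop where
  contDiff : ∀ x k, ContDiffOn ℝ (q + 1 : ℕ) (fun τ => φt τ x k) (Icc 0 δ)
  bound : ∃ μ : (Fin M → ℕ) → ℕ → (Fin N → ℤ) → ℝ,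
    (∀ k, ∀ i ≤ q + 1, ∀ x, ∀ τ ∈ Icc 0 δ,
      |iteratedDerivWithin i (fun t => φt t x k) (Icc 0 δ) τ| ≤ μ k i x) ∧
    ∀ r : ℕ, ∀ i ≤ q + 1, ∃ η σ : ℝ, 0 ≤ σ ∧ ∀ x : Fin N → ℤ,
      Summable (fun k : Fin M → ℕ => nrmM (fun j => (k j : ℝ)) ^ r * μ k i x) ∧
      ∑' k : Fin M → ℕ, nrmM (fun j => (k j : ℝ)) ^ r * μ k i x ≤
        η * (1 + nrmN (fun l => (x l : ℝ)) ^ σ)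

/-- Pointwise consistency of order `q` of `φ` with `P` (with `φ` considered on `[0, δ]`):
`φ` is `q + 1` times continuously differentiable in `τ`, and its first `q` derivatives at `τ = 0`
are those of `P`. That `P` is smooth is stated as well, so that its derivatives are genuine. -/
def PointwiseConsistent {N : ℕ} (q : ℕ) (δ : ℝ)
    (φ P : ℝ → (Fin N → ℤ) → (Fin N → ℤ) → ℝ) : Prop :=
  ∀ x x' : Fin N → ℤ,
    ContDiffOn ℝ (q + 1 : ℕ) (fun τ => φ τ x x') (Icc 0 δ) ∧
    ContDiffOn ℝ (⊤ : ℕ∞) (fun τ => P τ x x') (Ici 0) ∧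
    ∀ i, 1 ≤ i → i ≤ q →
      iteratedDerivWithin i (fun τ => φ τ x x') (Icc 0 δ) 0 =
        iteratedDerivWithin i (fun τ => P τ x x') (Ici 0) 0

end

noncomputable section

/-- Termwise differentiation of a series on a compact interval. -/
theorem hasDerivWithinAt_tsum_Icc {ι : Type*} {δ : ℝ} (hδ : 0 ≤ δ) {f f' : ι → ℝ → ℝ} {u : ι → ℝ}
    (hu : Summable u)
    (hf : ∀ k, ∀ t ∈ Icc 0 δ, HasDerivWithinAt (f k) (f' k t) (Icc 0 δ) t)
    (hc : ∀ k, ContinuousOn (f' k) (Icc 0 δ))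
    (hb : ∀ k, ∀ t ∈ Icc 0 δ, |f' k t| ≤ u k)
    (h0 : Summable fun k => f k 0) {t : ℝ} (ht : t ∈ Icc 0 δ) :
    HasDerivWithinAt (fun t => ∑' k, f k t) (∑' k, f' k t) (Icc 0 δ) t := by
  set G : ι → ℝ → ℝ := fun k => IccExtend hδ ((Icc 0 δ).domRestrict (f' k)) with hG
  have hGc : ∀ k, Continuous (G k) := fun k => (hc k).domRestrict.Icc_extend'
  have hGe : ∀ k, ∀ s ∈ Icc 0 δ, G k s = f' k s := fun k s hs => by
    simp [hG, IccExtend_of_mem hδ _ hs, domRestrict_apply]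
  have hGb : ∀ k s, ‖G k s‖ ≤ u k := fun k s => hb k _ (projIcc 0 δ hδ s).2
  have hD : ∀ k s, HasDerivAt (fun s => f k 0 + ∫ r in (0 : ℝ)..s, G k r) (G k s) s := fun k s =>
    ((hGc k).integral_hasStrictDerivAt 0 s).hasDerivAt.const_add _
  have key : ∀ k, ∀ s ∈ Icc 0 δ, f k s = f k 0 + ∫ r in (0 : ℝ)..s, G k r := by
    intro k s hs
    have h1 : ∫ r in (0 : ℝ)..s, G k r = f k s - f k 0 := by
      refine intervalIntegral.integral_eq_sub_of_hasDerivAt_of_le hs.1 ?_ ?_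
        ((hGc k).intervalIntegrable _ _)
      · exact fun r hr => ((hf k r ⟨hr.1, hr.2.trans hs.2⟩).continuousWithinAt).mono
          (Icc_subset_Icc_right hs.2)
      · intro r hr
        have hr' : r ∈ Icc 0 δ := ⟨hr.1.le, hr.2.le.trans hs.2⟩
        rw [hGe k r hr']
        exact (hf k r hr').hasDerivAt (Icc_mem_nhds hr.1 (hr.2.trans_le hs.2))
    linarith
  have hS := hasDerivAt_tsum (y₀ := 0) hu hD hGb (by simpa using h0) t
  rw [tsum_congr fun k => hGe k t ht] at hS
  exact hS.hasDerivWithinAt.congr (fun s hs => tsum_congr fun k => key k s hs)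
    (tsum_congr fun k => key k t ht)

/-- A series of `C^n` functions on a compact interval whose derivatives up to the order `n` are
bounded by summable constants can be differentiated termwise `n` times. -/
theorem contDiffOn_tsum_Icc {ι : Type*} {δ : ℝ} (hδ : 0 < δ) {n : ℕ} {f : ι → ℝ → ℝ}
    {u : ℕ → ι → ℝ} (hf : ∀ k, ContDiffOn ℝ n (f k) (Icc 0 δ))
    (hu : ∀ i ≤ n, Summable (u i))
    (hb : ∀ k, ∀ i ≤ n, ∀ t ∈ Icc 0 δ, |iteratedDerivWithin i (f k) (Icc 0 δ) t| ≤ u i k) :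
    ContDiffOn ℝ n (fun t => ∑' k, f k t) (Icc 0 δ) ∧
      ∀ i ≤ n, ∀ t ∈ Icc 0 δ, iteratedDerivWithin i (fun t => ∑' k, f k t) (Icc 0 δ) t =
        ∑' k, iteratedDerivWithin i (f k) (Icc 0 δ) t := by
  have hU : UniqueDiffOn ℝ (Icc 0 δ) := uniqueDiffOn_Icc hδ
  have hf' := fun k => (contDiffOn_nat_iff_continuousOn_differentiableOn_deriv hU).1 (hf k)
  have hD : ∀ i < n, ∀ t ∈ Icc 0 δ,
      HasDerivWithinAt (fun t => ∑' k, iteratedDerivWithin i (f k) (Icc 0 δ) t)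
        (∑' k, iteratedDerivWithin (i + 1) (f k) (Icc 0 δ) t) (Icc 0 δ) t := by
    intro i hi t ht
    refine hasDerivWithinAt_tsum_Icc hδ.le (hu (i + 1) hi) (fun k s hs => ?_)
      (fun k => (hf' k).1 _ hi) (fun k => hb k _ hi) ?_ ht
    · rw [iteratedDerivWithin_succ]
      exact ((hf' k).2 i hi s hs).hasDerivWithinAt
    · exact (hu i hi.le).of_norm_bounded (fun k => hb k i hi.le 0 (left_mem_Icc.2 hδ.le))
  have hE : ∀ i ≤ n, ∀ t ∈ Icc 0 δ, iteratedDerivWithin i (fun t => ∑' k, f k t) (Icc 0 δ) t =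
        ∑' k, iteratedDerivWithin i (f k) (Icc 0 δ) t := by
    intro i
    induction i with
    | zero => simp
    | succ i ih =>
      intro hi t ht
      rw [iteratedDerivWithin_succ, derivWithin_congr (fun s hs => ih (by omega) s hs)
        (ih (by omega) t ht)]
      exact (hD i hi t ht).derivWithin (hU t ht)
  refine ⟨(contDiffOn_nat_iff_continuousOn_differentiableOn_deriv hU).2 ⟨fun m hm => ?_,
    fun m hm => ?_⟩, hE⟩
  · refine ContinuousOn.congr ?_ (hE m hm)
    exact continuousOn_tsum (fun k => (hf' k).1 m hm) (hu m hm) (fun k t ht => hb k m hm t ht)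
  · exact DifferentiableOn.congr (fun t ht => (hD m hm t ht).differentiableWithinAt) (hE m hm.le)

namespace ReactionNetwork

variable {N M : ℕ} (net : ReactionNetwork N M)

/-- The generator of the chemical process. -/
def generator (f : (Fin N → ℤ) → ℝ) (x : Fin N → ℤ) : ℝ :=
  ∑ j, net.a j x * (f (x + net.ν j) - f x)

theorem shift_add_single (x : Fin N → ℤ) (k : Fin M → ℕ) (j : Fin M) :
    net.shift x (k + Pi.single j 1) = net.shift x k + net.ν j := by
  simp [shift, add_smul, Finset.sum_add_distrib, Pi.single_apply, add_assoc]

theorem hasSum_Qtilde_mul (x : Fin N → ℤ) (f : (Fin N → ℤ) → ℝ) (m : Fin M → ℕ) :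
    HasSum (fun k => net.Qtilde x m k * f (net.shift x k)) (net.generator f (net.shift x m)) := by
  have h1 : ∀ j, HasSum (fun k => (if k = m + Pi.single j 1 then net.a j (net.shift x m) else 0) *
      f (net.shift x k)) (net.a j (net.shift x m) * f (net.shift x m + net.ν j)) := by
    intro j
    convert hasSum_single (m + Pi.single j 1) ?_ using 1
    · simp [shift_add_single]
    · intro k hk; simp [hk]
  have h2 : HasSum (fun k => (if k = m then net.a₀ (net.shift x m) else 0) *
      f (net.shift x k)) (net.a₀ (net.shift x m) * f (net.shift x m)) := by
    convert hasSum_single m ?_ using 1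
    · simp
    · intro k hk; simp [hk]
  have h3 := (hasSum_sum fun j (_ : j ∈ Finset.univ) => h1 j).sub h2
  have e1 : (fun k => net.Qtilde x m k * f (net.shift x k)) = fun k =>
      ∑ j, (if k = m + Pi.single j 1 then net.a j (net.shift x m) else 0) * f (net.shift x k) -
        (if k = m then net.a₀ (net.shift x m) else 0) * f (net.shift x k) := by
    ext k; rw [Qtilde, sub_mul, Finset.sum_mul]
  have e2 : net.generator f (net.shift x m) = ∑ j, net.a j (net.shift x m) *
      f (net.shift x m + net.ν j) - net.a₀ (net.shift x m) * f (net.shift x m) := by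
    simp only [generator, mul_sub, a₀, Finset.sum_mul, Finset.sum_sub_distrib]
  rw [e1, e2]
  exact h3

theorem finite_support_Qtilde (x : Fin N → ℤ) (m : Fin M → ℕ) :
    (Function.support (net.Qtilde x m)).Finite := by
  refine ((Set.finite_singleton m).union
    (Set.finite_range fun j : Fin M => m + Pi.single j 1)).subset ?_
  intro k hk
  by_contra h
  simp only [mem_union, mem_singleton_iff, mem_range, not_or, not_exists] at h
  refine hk ?_
  simp [Qtilde, h.1, fun j => Ne.symm (h.2 j)]

theorem finite_support_matPow (x : Fin N → ℤ) (n : ℕ) (k : Fin M → ℕ) :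
    (Function.support (matPow (net.Qtilde x) n k)).Finite := by
  induction n with
  | zero =>
    refine (Set.finite_singleton k).subset fun l hl => ?_
    by_contra h
    exact hl (by simp [matPow, Ne.symm h])
  | succ n ih =>
    refine (ih.biUnion fun m _ => net.finite_support_Qtilde x m).subset fun l hl => ?_
    by_contra h
    refine hl ?_
    simp only [mem_iUnion, not_exists, Function.mem_support, not_not] at h
    refine (tsum_congr fun m => ?_).trans tsum_zero
    by_cases hm : matPow (net.Qtilde x) n k m = 0
    · simp [hm]
    · simp [h m hm]

/-- The powers of `Q̃(x)` describe the powers of the generator. -/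
theorem hasSum_matPow_mul (x : Fin N → ℤ) (n : ℕ) (f : (Fin N → ℤ) → ℝ) :
    HasSum (fun k => matPow (net.Qtilde x) n 0 k * f (net.shift x k))
      (net.generator^[n] f x) := by
  induction n generalizing f with
  | zero =>
    convert hasSum_single (0 : Fin M → ℕ) ?_ using 1
    · simp [matPow, shift]
    · intro k hk; simp [matPow, Ne.symm hk]
  | succ n ih =>
    set s := (net.finite_support_matPow x n 0).toFinset with hs
    have hs' : ∀ m ∉ s, matPow (net.Qtilde x) n 0 m = 0 := fun m hm => by
      simpa [hs] using hm
    have h1 : ∀ k, matPow (net.Qtilde x) (n + 1) 0 k =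
        ∑ m ∈ s, net.Qtilde x m k * matPow (net.Qtilde x) n 0 m := fun k =>
      tsum_eq_sum fun m hm => by simp [hs' m hm]
    have h2 : net.generator^[n + 1] f x =
        ∑ m ∈ s, net.generator f (net.shift x m) * matPow (net.Qtilde x) n 0 m := by
      rw [Function.iterate_succ_apply, (ih (net.generator f)).unique
        (hasSum_sum_of_ne_finset_zero (s := s) fun m hm => by simp [hs' m hm])]
      exact Finset.sum_congr rfl fun m _ => mul_comm _ _
    have h3 : (fun k => matPow (net.Qtilde x) (n + 1) 0 k * f (net.shift x k)) = fun k =>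
        ∑ m ∈ s, net.Qtilde x m k * f (net.shift x k) * matPow (net.Qtilde x) n 0 m := by
      ext k
      rw [h1, Finset.sum_mul]
      exact Finset.sum_congr rfl fun m _ => by ring
    rw [h2, h3]
    exact hasSum_sum fun m _ =>
      (net.hasSum_Qtilde_mul x f m).mul_right (matPow (net.Qtilde x) n 0 m)

theorem tsum_countSet_matPow (x x' : Fin N → ℤ) (n : ℕ) :
    ∑' k : net.countSet x x', matPow (net.Qtilde x) n 0 k =
      net.generator^[n] (fun y => if y = x' then 1 else 0) x := by
  rw [← (net.hasSum_matPow_mul x n _).tsum_eq, tsum_subtype]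
  refine tsum_congr fun k => ?_
  by_cases h : x' = net.shift x k
  · rw [indicator_of_mem (show k ∈ net.countSet x x' from h)]; simp [h]
  · rw [indicator_of_notMem (show k ∉ net.countSet x x' from h)]; simp [Ne.symm h]

/-- Smoothness of the solutions of the backward equation, whose derivatives are given by the powers
of the generator. -/
theorem contDiffOn_of_backward {p : ℝ → (Fin N → ℤ) → ℝ}
    (hp : ∀ x, ∀ t ∈ Ici (0 : ℝ),
      HasDerivWithinAt (fun t => p t x) (net.generator (p t) x) (Ici 0) t) (x : Fin N → ℤ) :
    ContDiffOn ℝ (⊤ : ℕ∞) (fun t => p t x) (Ici 0) ∧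
      ∀ i, ∀ t ∈ Ici (0 : ℝ), iteratedDerivWithin i (fun t => p t x) (Ici 0) t =
        net.generator^[i] (p t) x := by
  have hU : UniqueDiffOn ℝ (Ici (0 : ℝ)) := uniqueDiffOn_Ici 0
  have hD : ∀ i x, ∀ t ∈ Ici (0 : ℝ), HasDerivWithinAt (fun t => net.generator^[i] (p t) x)
      (net.generator^[i + 1] (p t) x) (Ici 0) t := by
    intro i
    induction i with
    | zero => simpa using hp
    | succ i ih =>
      intro x t ht
      simp only [Function.iterate_succ_apply'] at ih ⊢
      exact HasDerivWithinAt.fun_sum fun j _ =>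
        ((ih (x + net.ν j) t ht).sub (ih x t ht)).const_mul (net.a j x)
  have hE : ∀ i, ∀ t ∈ Ici (0 : ℝ), iteratedDerivWithin i (fun t => p t x) (Ici 0) t =
        net.generator^[i] (p t) x := by
    intro i
    induction i with
    | zero => simp
    | succ i ih =>
      intro t ht
      rw [iteratedDerivWithin_succ, derivWithin_congr ih (ih t ht)]
      exact (hD i x t ht).derivWithin (hU t ht)
  refine ⟨contDiffOn_of_differentiableOn_deriv fun m _ => ?_, hE⟩
  exact DifferentiableOn.congr (fun t ht => (hD m x t ht).differentiableWithinAt) (hE m)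

end ReactionNetwork

/-- The exponential distribution of rate `r ≥ 0` on `[0, ∞]`; it is concentrated at `∞` if
`r = 0`. -/
def waitingLaw (r : ℝ) : Measure ℝ≥0∞ :=
  open Classical in
  if 0 < r then (ProbabilityTheory.expMeasure r).map ENNReal.ofReal else Measure.dirac ∞

theorem waitingLaw_of_pos {r : ℝ} (hr : 0 < r) :
    waitingLaw r = (ProbabilityTheory.expMeasure r).map ENNReal.ofReal := if_pos hr

theorem waitingLaw_zero : waitingLaw 0 = Measure.dirac ∞ := if_neg (lt_irrefl 0)

instance isProbabilityMeasure_waitingLaw (r : ℝ) : IsProbabilityMeasure (waitingLaw r) := by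
  unfold waitingLaw
  split_ifs with hr
  · have := ProbabilityTheory.isProbabilityMeasure_expMeasure hr
    exact Measure.isProbabilityMeasure_map ENNReal.measurable_ofReal.aemeasurable
  · infer_instance

theorem waitingLaw_Ioi {r s : ℝ} (hr : 0 ≤ r) (hs : 0 ≤ s) :
    waitingLaw r (Ioi (ENNReal.ofReal s)) = ENNReal.ofReal (Real.exp (-(r * s))) := by
  rcases hr.eq_or_lt with rfl | hr
  · simp [waitingLaw_zero]
  have := ProbabilityTheory.isProbabilityMeasure_expMeasure hr
  have h1 : ENNReal.ofReal ⁻¹' Ioi (ENNReal.ofReal s) = (Iic s)ᶜ := by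
    ext y
    simp only [mem_preimage, mem_Ioi, compl_Iic]
    constructor
    · intro h
      by_contra h'
      exact absurd (ENNReal.ofReal_le_ofReal (not_lt.1 h')) (not_le.2 h)
    · intro h
      exact (ENNReal.ofReal_lt_ofReal_iff (hs.trans_lt h)).2 h
  have h2 : ProbabilityTheory.expMeasure r (Iic s) =
      ENNReal.ofReal (1 - Real.exp (-(r * s))) := by
    rw [← ENNReal.ofReal_toReal (measure_ne_top (ProbabilityTheory.expMeasure r) (Iic s)),
      ← measureReal_def, ← ProbabilityTheory.cdf_eq_real, ProbabilityTheory.cdf_expMeasure_eq hr,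
      if_pos hs]
  rw [waitingLaw_of_pos hr, Measure.map_apply ENNReal.measurable_ofReal measurableSet_Ioi, h1,
    prob_compl_eq_one_sub measurableSet_Iic, h2, ← ENNReal.ofReal_one,
    ← ENNReal.ofReal_sub]
  · simp
  · simp only [sub_nonneg, Real.exp_le_one_iff]; nlinarith [mul_nonneg hr.le hs]

theorem lintegral_waitingLaw {r : ℝ} (hr : 0 < r) {f : ℝ≥0∞ → ℝ≥0∞} (hf : Measurable f) :
    ∫⁻ y, f y ∂waitingLaw r =
      ∫⁻ s in Ici 0, ENNReal.ofReal (r * Real.exp (-(r * s))) * f (ENNReal.ofReal s) := by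
  have h1 : ProbabilityTheory.expMeasure r =
      volume.withDensity (ProbabilityTheory.exponentialPDF r) := rfl
  have h2 : Measurable (ProbabilityTheory.exponentialPDF r) :=
    (ProbabilityTheory.measurable_exponentialPDFReal r).ennreal_ofReal
  have h3 : Measurable fun s => f (ENNReal.ofReal s) := hf.comp ENNReal.measurable_ofReal
  rw [waitingLaw_of_pos hr, lintegral_map hf ENNReal.measurable_ofReal, h1,
    lintegral_withDensity_eq_lintegral_mul _ h2 h3, ← lintegral_indicator measurableSet_Ici]
  refine lintegral_congr fun s => ?_
  by_cases hs : 0 ≤ s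
  · rw [indicator_of_mem (mem_Ici.2 hs), Pi.mul_apply,
      ProbabilityTheory.exponentialPDF_of_nonneg hs]
  · rw [indicator_of_notMem (by simpa using hs), Pi.mul_apply,
      ProbabilityTheory.exponentialPDF_of_neg (not_le.1 hs), zero_mul]

/-- A finite measure with the joint survival function of independent exponential times is a
multiple of a product measure. -/
theorem map_eq_smul_pi_waitingLaw {Ω : Type*} [MeasurableSpace Ω] {m : Measure Ω}
    [IsFiniteMeasure m] {n : ℕ} {T : Fin n → Ω → ℝ≥0∞} (hT : ∀ i, Measurable (T i))
    {r : Fin n → ℝ} (hr : ∀ i, 0 ≤ r i) (hpos : ∀ᵐ ω ∂m, ∀ i, 0 < T i ω)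
    {K : ℝ≥0∞}
    (h : ∀ s : Fin n → ℝ, (∀ i, 0 ≤ s i) → m {ω | ∀ i, ENNReal.ofReal (s i) < T i ω} =
      K * ∏ i, ENNReal.ofReal (Real.exp (-(r i * s i)))) :
    m.map (fun ω i => T i ω) = K • Measure.pi fun i => waitingLaw (r i) := by
  have hTm : Measurable fun ω i => T i ω := measurable_pi_lambda _ hT
  have hK : m univ = K := by
    have h0 : m {ω | ∀ i, 0 < T i ω} = K := by simpa using h 0 (by simp)
    rw [← h0]
    refine (measure_congr ?_).symm
    filter_upwards [hpos] with ω hω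
    exact propext ⟨fun _ => trivial, fun _ => hω⟩
  rcases eq_or_ne K 0 with rfl | hK0
  · rw [zero_smul, Measure.measure_univ_eq_zero.1 hK, Measure.map_zero]
  have hKt : K ≠ ∞ := hK ▸ measure_ne_top m univ
  set C : Set (Set ℝ≥0∞) := insert univ (range Ioi) with hC
  suffices hpi : Measure.pi (fun i => waitingLaw (r i)) = K⁻¹ • m.map (fun ω i => T i ω) by
    rw [hpi, smul_smul, ENNReal.mul_inv_cancel hK0 hKt, one_smul]
  have hCpi : IsPiSystem C := by
    rintro _ (rfl | ⟨a, rfl⟩) _ (rfl | ⟨b, rfl⟩) _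
    · simp [hC]
    · simp [hC]
    · simp [hC]
    · rw [Ioi_inter_Ioi]; exact Or.inr ⟨_, rfl⟩
  have hCgen : MeasurableSpace.generateFrom C = ENNReal.measurableSpace := by
    rw [hC, MeasurableSpace.generateFrom_insert_univ, ← borel_eq_generateFrom_Ioi,
      BorelSpace.measurable_eq (α := ℝ≥0∞)]
  refine Measure.pi_eq_generateFrom (C := fun _ => C) (fun _ => hCgen) (fun _ => hCpi)
    (fun i => ⟨fun _ => univ, fun _ => Or.inl rfl, fun _ => measure_lt_top _ _, iUnion_const _⟩) ?_
  intro s hs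
  by_cases htop : ∃ i, s i = Ioi ∞
  · obtain ⟨i, hi⟩ := htop
    have hi' : s i = ∅ := by rw [hi, Ioi_top]
    rw [univ_pi_eq_empty hi', measure_empty,
      Finset.prod_eq_zero (Finset.mem_univ i) (by rw [hi', measure_empty])]
  have hs' : ∀ i, ∃ a : ℝ, 0 ≤ a ∧ (s i = Ioi (ENNReal.ofReal a) ∨ s i = univ ∧ a = 0) := by
    intro i
    rcases hs i with hi | ⟨a, hi⟩
    · exact ⟨0, le_rfl, Or.inr ⟨hi, rfl⟩⟩
    · refine ⟨a.toReal, ENNReal.toReal_nonneg, Or.inl ?_⟩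
      rw [ENNReal.ofReal_toReal, hi]
      rintro rfl
      exact htop ⟨i, hi.symm⟩
  choose a ha0 ha using hs'
  have h1 : m.map (fun ω i => T i ω) (univ.pi s) = m {ω | ∀ i, ENNReal.ofReal (a i) < T i ω} := by
    have hsm : MeasurableSet (univ.pi s) := MeasurableSet.univ_pi fun i => by
      rcases ha i with hi | hi
      · rw [hi]; exact measurableSet_Ioi
      · rw [hi.1]; exact MeasurableSet.univ
    rw [Measure.map_apply hTm hsm]
    refine measure_congr ?_
    filter_upwards [hpos] with ω hω
    refine propext (forall_congr' fun i => ?_)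
    rcases ha i with hi | hi
    · simp [hi]
    · simp [hi.1, hi.2, hω i]
  have h2 : ∀ i, waitingLaw (r i) (s i) = ENNReal.ofReal (Real.exp (-(r i * a i))) := by
    intro i
    rcases ha i with hi | hi
    · rw [hi, waitingLaw_Ioi (hr i) (ha0 i)]
    · simp [hi.1, hi.2]
  rw [Measure.smul_apply, h1, h a ha0, smul_eq_mul, ← mul_assoc, ENNReal.inv_mul_cancel hK0 hKt,
    one_mul]
  exact Finset.prod_congr rfl fun i _ => (h2 i).symm

/-- The waiting times for which exactly `n` jumps occur up to the time `t`. -/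
def exactJumps (n : ℕ) (t : ℝ≥0∞) : Set (Fin (n + 1) → ℝ≥0∞) :=
  {y | ∑ i : Fin n, y i.castSucc ≤ t ∧ t < ∑ i, y i}

theorem measurableSet_exactJumps (n : ℕ) (t : ℝ≥0∞) : MeasurableSet (exactJumps n t) :=
  (measurableSet_le (f := fun y : Fin (n + 1) → ℝ≥0∞ => ∑ i : Fin n, y i.castSucc) (by fun_prop)
    measurable_const).inter
    (measurableSet_lt (g := fun y : Fin (n + 1) → ℝ≥0∞ => ∑ i, y i) measurable_const (by fun_prop))

theorem pi_exactJumps_zero (μ : Fin 1 → Measure ℝ≥0∞) [∀ i, IsProbabilityMeasure (μ i)]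
    (t : ℝ≥0∞) : Measure.pi μ (exactJumps 0 t) = μ 0 (Ioi t) := by
  have : exactJumps 0 t = univ.pi fun _ => Ioi t := by ext y; simp [exactJumps]
  rw [this, Measure.pi_pi]; simp

theorem pi_exactJumps_succ {n : ℕ} (μ : Fin (n + 2) → Measure ℝ≥0∞)
    [∀ i, IsProbabilityMeasure (μ i)] {t : ℝ≥0∞} (ht : t ≠ ∞) :
    Measure.pi μ (exactJumps (n + 1) t) =
      ∫⁻ y in Iic t, Measure.pi (fun i => μ (Fin.succ i)) (exactJumps n (t - y)) ∂μ 0 := by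
  have hmp := (measurePreserving_piFinSuccAbove μ 0).symm
  have hms : MeasurableSet ((MeasurableEquiv.piFinSuccAbove (fun _ => ℝ≥0∞) 0).symm ⁻¹'
      exactJumps (n + 1) t) := MeasurableEquiv.measurable _ (measurableSet_exactJumps _ _)
  rw [← hmp.measure_preimage (measurableSet_exactJumps _ _).nullMeasurableSet,
    Measure.prod_apply hms, ← lintegral_indicator measurableSet_Iic]
  refine lintegral_congr fun y => ?_
  simp only [Fin.succAbove_zero]
  have hmem : ∀ z : Fin (n + 1) → ℝ≥0∞, (MeasurableEquiv.piFinSuccAbove (fun _ => ℝ≥0∞) 0).symm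
      (y, z) ∈ exactJumps (n + 1) t ↔
        y + ∑ i : Fin n, z i.castSucc ≤ t ∧ t < y + ∑ i, z i := by
    intro z
    simp only [exactJumps, mem_ofPred_eq, MeasurableEquiv.piFinSuccAbove_symm_apply,
      Fin.insertNthEquiv_zero, Fin.consEquiv_apply, Fin.sum_univ_succ (n := n + 1),
      Fin.sum_univ_succ (n := n), Fin.castSucc_zero, Fin.cons_zero, ← Fin.succ_castSucc,
      Fin.cons_succ]
  by_cases hy : y ≤ t
  · rw [indicator_of_mem (mem_Iic.2 hy)]
    congr 1
    ext z
    have hyt : y ≠ ∞ := ne_top_of_le_ne_top ht hy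
    refine (hmem z).trans (and_congr ?_ ?_)
    · exact (ENNReal.le_sub_iff_add_le_left hyt hy).symm
    · exact (ENNReal.sub_lt_iff_lt_left hyt hy).symm
  · rw [indicator_of_notMem (by simpa using hy)]
    refine (congrArg _ (eq_empty_of_forall_notMem fun z hz => hy ?_)).trans measure_empty
    exact le_self_add.trans ((hmem z).1 hz).1

namespace ReactionNetwork

variable {N M : ℕ} (net : ReactionNetwork N M)

theorem a₀_nonneg (x : Fin N → ℤ) : 0 ≤ net.a₀ x :=
  Finset.sum_nonneg fun j _ => net.a_nonneg j x

theorem jumpProb_nonneg (x : Fin N → ℤ) (o : Option (Fin M)) : 0 ≤ net.jumpProb x o := by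
  cases o with
  | none => unfold jumpProb; split_ifs <;> norm_num
  | some j =>
    unfold jumpProb
    split_ifs
    · exact le_rfl
    · exact div_nonneg (net.a_nonneg j x) (net.a₀_nonneg x)

theorem sum_jumpProb (x : Fin N → ℤ) : ∑ o, net.jumpProb x o = 1 := by
  rw [Fintype.sum_option]
  by_cases h : net.a₀ x = 0
  · simp [jumpProb, h]
  · simp only [jumpProb, h, if_false, zero_add]
    rw [← Finset.sum_div]
    exact div_self h

/-- The probability that the first `n` channels to fire are those listed in `c`. -/
def chainProb (x : Fin N → ℤ) (c : ℕ → Option (Fin M)) (n : ℕ) : ℝ≥0∞ :=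
  ENNReal.ofReal (∏ i ∈ Finset.range n, net.jumpProb (net.chain x c i) (c i))

theorem chainProb_ne_top (x : Fin N → ℤ) (c : ℕ → Option (Fin M)) (n : ℕ) :
    net.chainProb x c n ≠ ∞ := ENNReal.ofReal_ne_top

theorem chain_congr {x : Fin N → ℤ} {c c' : ℕ → Option (Fin M)} {n : ℕ}
    (h : ∀ i < n, c i = c' i) : net.chain x c n = net.chain x c' n := by
  unfold chain
  congr 1
  exact Finset.sum_congr rfl fun i hi => by rw [h i (Finset.mem_range.1 hi)]

theorem chainProb_congr {x : Fin N → ℤ} {c c' : ℕ → Option (Fin M)} {n : ℕ}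
    (h : ∀ i < n, c i = c' i) : net.chainProb x c n = net.chainProb x c' n := by
  unfold chainProb
  congr 1
  refine Finset.prod_congr rfl fun i hi => ?_
  have hi' := Finset.mem_range.1 hi
  rw [h i hi', net.chain_congr fun k hk => h k (hk.trans hi')]

theorem chainProb_succ (x : Fin N → ℤ) (c : ℕ → Option (Fin M)) (n : ℕ) :
    net.chainProb x c (n + 1) =
      net.chainProb x c n * ENNReal.ofReal (net.jumpProb (net.chain x c n) (c n)) := by
  rw [chainProb, Finset.prod_range_succ, ENNReal.ofReal_mul
    (Finset.prod_nonneg fun i _ => net.jumpProb_nonneg _ _), chainProb]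

theorem chain_cons (x : Fin N → ℤ) (o : Option (Fin M)) (l : List (Option (Fin M))) (n : ℕ) :
    net.chain x (fun i => (o :: l).getD i none) (n + 1) =
      net.chain (x + o.elim 0 net.ν) (fun i => l.getD i none) n := by
  simp only [chain, Finset.sum_range_succ', List.getD_cons_succ, List.getD_cons_zero]
  abel

theorem chainProb_cons (x : Fin N → ℤ) (o : Option (Fin M)) (l : List (Option (Fin M))) (n : ℕ) :
    net.chainProb x (fun i => (o :: l).getD i none) (n + 1) =
      ENNReal.ofReal (net.jumpProb x o) *
        net.chainProb (x + o.elim 0 net.ν) (fun i => l.getD i none) n := by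
  rw [chainProb, Finset.prod_range_succ', mul_comm, ENNReal.ofReal_mul (net.jumpProb_nonneg _ _)]
  simp only [chain_cons, List.getD_cons_succ, List.getD_cons_zero, chainProb]
  simp [chain]

/-- The probability that, started at `x`, exactly the reactions listed in `l` fire up to
the time `t`. -/
def pathProb : List (Option (Fin M)) → (Fin N → ℤ) → ℝ≥0∞ → ℝ≥0∞
  | [], x, t => waitingLaw (net.a₀ x) (Ioi t)
  | o :: l, x, t => ENNReal.ofReal (net.jumpProb x o) *
      ∫⁻ y in Iic t, pathProb l (x + o.elim 0 net.ν) (t - y) ∂waitingLaw (net.a₀ x)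

theorem pathProb_eq (l : List (Option (Fin M))) (x : Fin N → ℤ) {t : ℝ≥0∞} (ht : t ≠ ∞) :
    net.chainProb x (fun i => l.getD i none) l.length *
      Measure.pi (fun i : Fin (l.length + 1) =>
        waitingLaw (net.a₀ (net.chain x (fun i => l.getD i none) i))) (exactJumps l.length t) =
      net.pathProb l x t := by
  induction l generalizing x t with
  | nil =>
    simp only [List.length_nil, pathProb]
    rw [pi_exactJumps_zero]
    simp [chainProb, chain]
  | cons o l ih =>
    simp only [List.length_cons, pathProb]
    rw [pi_exactJumps_succ _ ht, chainProb_cons, mul_assoc,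
      ← lintegral_const_mul' _ _ (net.chainProb_ne_top _ _ _)]
    congr 1
    have h0 : net.chain x (fun i => (o :: l).getD i none) ((0 : Fin (l.length + 2)) : ℕ) = x := by
      simp [chain]
    rw [h0]
    refine lintegral_congr fun y => ?_
    rw [← ih _ (ENNReal.sub_ne_top ht)]
    simp only [Fin.val_succ, chain_cons]

end ReactionNetwork

namespace ChemicalProcess

variable {N M : ℕ} {net : ReactionNetwork N M} {x : Fin N → ℤ} {Ω : Type*} [MeasurableSpace Ω]
  (X : ChemicalProcess net x Ω)

theorem measurableSet_channels (c : ℕ → Option (Fin M)) (n : ℕ) :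
    MeasurableSet {ω | ∀ i < n, X.J i ω = c i} := by
  have : {ω | ∀ i < n, X.J i ω = c i} = ⋂ i, ⋂ (_ : i < n), {ω | X.J i ω = c i} := by
    ext; simp
  rw [this]
  exact MeasurableSet.iInter fun i => MeasurableSet.iInter fun _ => X.measurableSet_J i (c i)

theorem measurable_jumpTime (n : ℕ) : Measurable (X.jumpTime n) :=
  Finset.measurable_sum _ fun i _ => X.measurable_S i

theorem prob_channels_pos (c : ℕ → Option (Fin M)) (n : ℕ) :
    X.prob {ω | (∀ i < n, X.J i ω = c i) ∧ ∀ i ≤ n, 0 < X.S i ω} = net.chainProb x c n := by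
  simpa [ReactionNetwork.chainProb] using X.law n c 0 fun _ => le_rfl

theorem ae_S_pos : ∀ᵐ ω ∂X.prob, ∀ i, 0 < X.S i ω := by
  have := X.isProb
  have h0 : ∀ᵐ ω ∂X.prob, 0 < X.S 0 ω := by
    have h := X.prob_channels_pos (fun _ => none) 0
    have hm : MeasurableSet {ω | 0 < X.S 0 ω} := measurableSet_lt measurable_const (X.measurable_S 0)
    refine (mem_ae_iff_prob_eq_one hm).2 ?_
    simpa [ReactionNetwork.chainProb] using h
  have hstep : ∀ l : List (Option (Fin M)), ∀ᵐ ω ∂X.prob,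
      ((∀ i < l.length, X.J i ω = l.getD i none) ∧ ∀ i ≤ l.length, 0 < X.S i ω) →
        0 < X.S (l.length + 1) ω := by
    intro l
    set n := l.length
    set c : ℕ → Option (Fin M) := fun i => l.getD i none
    set D : Set Ω := {ω | (∀ i < n, X.J i ω = c i) ∧ ∀ i ≤ n, 0 < X.S i ω} with hD
    set c' : Option (Fin M) → ℕ → Option (Fin M) := fun o => Function.update c n o with hc'
    have hcc' : ∀ o, ∀ i < n, c' o i = c i := fun o i hi => by simp [hc', hi.ne]
    set D' : Option (Fin M) → Set Ω :=
      fun o => {ω | (∀ i < n + 1, X.J i ω = c' o i) ∧ ∀ i ≤ n + 1, 0 < X.S i ω} with hD'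
    have hSm : ∀ k, MeasurableSet {ω | ∀ i ≤ k, 0 < X.S i ω} := fun k => by
      have : {ω | ∀ i ≤ k, 0 < X.S i ω} = ⋂ i, ⋂ (_ : i ≤ k), {ω | 0 < X.S i ω} := by
        ext; simp
      rw [this]
      exact MeasurableSet.iInter fun i => MeasurableSet.iInter fun _ =>
        measurableSet_lt measurable_const (X.measurable_S i)
    have hD'm : ∀ o, MeasurableSet (D' o) := fun o =>
      (X.measurableSet_channels (c' o) (n + 1)).inter (hSm (n + 1))
    have hsub : (⋃ o, D' o) ⊆ D := by
      refine iUnion_subset fun o ω hω => ⟨fun i hi => ?_, fun i hi => hω.2 i (by omega)⟩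
      rw [hω.1 i (by omega), hcc' o i hi]
    have hdis : Pairwise (Function.onFun Disjoint D') := by
      intro o o' hoo'
      refine disjoint_left.2 fun ω h1 h2 => hoo' ?_
      have := (h1.1 n (by omega)).symm.trans (h2.1 n (by omega))
      simpa [hc'] using this
    have hval : X.prob (⋃ o, D' o) = X.prob D := by
      rw [measure_iUnion hdis hD'm, tsum_fintype]
      have h1 : ∀ o, X.prob (D' o) =
          net.chainProb x c n * ENNReal.ofReal (net.jumpProb (net.chain x c n) o) := by
        intro o
        rw [X.prob_channels_pos, net.chainProb_succ, net.chainProb_congr (hcc' o),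
          net.chain_congr (hcc' o)]
        simp [hc']
      rw [Finset.sum_congr rfl fun o _ => h1 o, ← Finset.mul_sum,
        ← ENNReal.ofReal_sum_of_nonneg fun o _ => net.jumpProb_nonneg _ _, net.sum_jumpProb,
        ENNReal.ofReal_one, mul_one, X.prob_channels_pos]
    have hae := ae_eq_of_subset_of_measure_ge hsub hval.ge
      (MeasurableSet.iUnion hD'm).nullMeasurableSet (measure_ne_top _ _)
    filter_upwards [hae.mem_iff] with ω hω hωD
    obtain ⟨o, ho⟩ := mem_iUnion.1 (hω.2 hωD)
    exact ho.2 (n + 1) le_rfl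
  filter_upwards [h0, ae_all_iff.2 hstep] with ω hω0 hω
  have hall : ∀ n, ∀ i ≤ n, 0 < X.S i ω := by
    intro n
    induction n with
    | zero => intro i hi; rwa [Nat.le_zero.1 hi]
    | succ n ih =>
      intro i hi
      rcases Nat.le_or_eq_of_le_succ hi with hi | rfl
      · exact ih i hi
      · have h := hω (List.ofFn fun i : Fin n => X.J i ω)
        simp only [List.length_ofFn] at h
        refine h ⟨fun i hi => ?_, ih⟩
        simp [List.getD_eq_getElem?_getD, hi]
  exact fun i => hall i i le_rfl

/-- The event that exactly the reactions listed in `l` fire up to the time `t`. -/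
def pathEvent (t : ℝ≥0∞) (l : List (Option (Fin M))) : Set Ω :=
  {ω | ∀ i < l.length, X.J i ω = l.getD i none} ∩
    {ω | X.jumpTime l.length ω ≤ t ∧ t < X.jumpTime (l.length + 1) ω}

theorem measurableSet_pathEvent (t : ℝ≥0∞) (l : List (Option (Fin M))) :
    MeasurableSet (X.pathEvent t l) :=
  (X.measurableSet_channels _ _).inter
    ((measurableSet_le (X.measurable_jumpTime _) measurable_const).inter
      (measurableSet_lt measurable_const (X.measurable_jumpTime _)))

theorem prob_pathEvent {t : ℝ≥0∞} (ht : t ≠ ∞) (l : List (Option (Fin M))) :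
    X.prob (X.pathEvent t l) = net.pathProb l x t := by
  have := X.isProb
  rw [← net.pathProb_eq l x ht]
  set n := l.length
  set c : ℕ → Option (Fin M) := fun i => l.getD i none
  have hTm : Measurable fun ω (i : Fin (n + 1)) => X.S i ω :=
    measurable_pi_lambda _ fun i => X.measurable_S i
  have hmap := map_eq_smul_pi_waitingLaw (m := X.prob.restrict {ω | ∀ i < n, X.J i ω = c i})
    (T := fun (i : Fin (n + 1)) => X.S i) (fun i => X.measurable_S i)
    (r := fun i => net.a₀ (net.chain x c i)) (fun i => net.a₀_nonneg _)
    ((ae_restrict_of_ae X.ae_S_pos).mono fun ω hω i => hω i)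
    (K := net.chainProb x c n) (by
      intro s hs
      have hl := X.law n c (fun i => if h : i < n + 1 then s ⟨i, h⟩ else 0)
        (fun i => by split_ifs; exacts [hs _, le_rfl])
      rw [Measure.restrict_apply' (X.measurableSet_channels c n), inter_comm]
      have hp : ∏ i ∈ Finset.range (n + 1), Real.exp (-(net.a₀ (net.chain x c i) *
          if h : i < n + 1 then s ⟨i, h⟩ else 0)) =
          ∏ i : Fin (n + 1), Real.exp (-(net.a₀ (net.chain x c i) * s i)) := by
        rw [← Fin.prod_univ_eq_prod_range]
        exact Finset.prod_congr rfl fun i _ => by rw [dif_pos i.2]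
      rw [hp, ENNReal.ofReal_mul (Finset.prod_nonneg fun i _ => net.jumpProb_nonneg _ _),
        ENNReal.ofReal_prod_of_nonneg fun i _ => (Real.exp_pos _).le] at hl
      rw [ReactionNetwork.chainProb, ← hl]
      congr 1
      ext ω
      refine and_congr Iff.rfl ⟨fun h i hi => ?_, fun h i => ?_⟩
      · have := h ⟨i, by omega⟩
        simpa [Nat.lt_succ_of_le hi] using this
      · have hi := h i (by omega)
        rwa [dif_pos i.2] at hi)
  have hev : X.prob (X.pathEvent t l) =
      (X.prob.restrict {ω | ∀ i < n, X.J i ω = c i}).map (fun ω (i : Fin (n + 1)) => X.S i ω)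
        (exactJumps n t) := by
    rw [Measure.map_apply hTm (measurableSet_exactJumps n t),
      Measure.restrict_apply' (X.measurableSet_channels c n), inter_comm]
    congr 1
    ext ω
    refine and_congr Iff.rfl ?_
    simp only [exactJumps, jumpTime, mem_preimage, mem_ofPred_eq, Finset.sum_range, Fin.val_castSucc]
    rfl
  rw [hev, hmap, Measure.smul_apply, smul_eq_mul]

theorem jumpTime_mono (ω : Ω) : Monotone fun n => X.jumpTime n ω := fun _ _ h =>
  Finset.sum_le_sum_of_subset (Finset.range_mono h)

theorem numJumps_eq {t : ℝ} {ω : Ω} {n : ℕ} (h1 : X.jumpTime n ω ≤ ENNReal.ofReal t)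
    (h2 : ENNReal.ofReal t < X.jumpTime (n + 1) ω) : X.numJumps t ω = n := by
  refine le_antisymm (Nat.sInf_le h2) (le_csInf ⟨n, h2⟩ fun m hm => ?_)
  by_contra! hmn
  exact absurd ((X.jumpTime_mono ω (Nat.succ_le_of_lt hmn)).trans h1) (not_le.2 hm)

theorem state_eq_of_mem_pathEvent {t : ℝ} {ω : Ω} {l : List (Option (Fin M))}
    (h : ω ∈ X.pathEvent (ENNReal.ofReal t) l) :
    X.state t ω = net.chain x (fun i => l.getD i none) l.length := by
  rw [state, X.numJumps_eq h.2.1 h.2.2]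
  exact net.chain_congr h.1

theorem disjoint_pathEvent (t : ℝ) {l l' : List (Option (Fin M))} (hl : l ≠ l') :
    Disjoint (X.pathEvent (ENNReal.ofReal t) l) (X.pathEvent (ENNReal.ofReal t) l') := by
  refine disjoint_left.2 fun ω h h' => hl ?_
  have hlen : l.length = l'.length :=
    (X.numJumps_eq h.2.1 h.2.2).symm.trans (X.numJumps_eq h'.2.1 h'.2.2)
  refine List.ext_getElem hlen fun i hi hi' => ?_
  have := (h.1 i hi).symm.trans (h'.1 i hi')
  simpa [List.getD_eq_getElem?_getD, hi, hi'] using this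

theorem ae_exists_pathEvent (t : ℝ) :
    ∀ᵐ ω ∂X.prob, ∃ l, ω ∈ X.pathEvent (ENNReal.ofReal t) l := by
  filter_upwards [X.nonexplosive] with ω hω
  have hex : ∃ n, ENNReal.ofReal t < X.jumpTime (n + 1) ω := by
    by_contra! h
    have : ∑' n, X.S n ω ≤ ENNReal.ofReal t := by
      refine ENNReal.summable.tsum_le_of_sum_range_le fun n => ?_
      exact (X.jumpTime_mono ω n.le_succ).trans (h n)
    rw [hω] at this
    exact absurd this (not_le.2 ENNReal.ofReal_lt_top)
  classical
  set n := Nat.find hex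
  refine ⟨List.ofFn fun i : Fin n => X.J i ω, fun i hi => ?_, ?_, ?_⟩
  · have hi' : i < n := by simpa using hi
    simp [List.getD_eq_getElem?_getD, hi']
  · rw [List.length_ofFn]
    rcases hn : n with _ | m
    · simp [jumpTime]
    · exact not_lt.1 (Nat.find_min hex (m := m) (by omega))
  · rw [List.length_ofFn]; exact Nat.find_spec hex

theorem prob_state_eq (t : ℝ) (x' : Fin N → ℤ) :
    X.prob {ω | X.state t ω = x'} =
      ∑' l : List (Option (Fin M)), if net.chain x (fun i => l.getD i none) l.length = x' then
        net.pathProb l x (ENNReal.ofReal t) else 0 := by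
  set B : List (Option (Fin M)) → Set Ω := fun l =>
    if net.chain x (fun i => l.getD i none) l.length = x' then X.pathEvent (ENNReal.ofReal t) l
    else ∅ with hB
  have hsub : ∀ l, B l ⊆ X.pathEvent (ENNReal.ofReal t) l := fun l => by
    simp only [hB]; split_ifs; exacts [Subset.rfl, empty_subset _]
  have hBm : ∀ l, MeasurableSet (B l) := fun l => by
    simp only [hB]; split_ifs; exacts [X.measurableSet_pathEvent _ _, MeasurableSet.empty]
  have h1 : X.prob {ω | X.state t ω = x'} = X.prob (⋃ l, B l) := by
    refine measure_congr ?_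
    filter_upwards [X.ae_exists_pathEvent t] with ω ⟨l, hl⟩
    refine propext ⟨fun h => ?_, fun h => ?_⟩
    · refine mem_iUnion.2 ⟨l, ?_⟩
      simp only [hB]
      rwa [if_pos ((X.state_eq_of_mem_pathEvent hl).symm.trans h)]
    · obtain ⟨l', hl'⟩ := mem_iUnion.1 h
      by_cases hx : net.chain x (fun i => l'.getD i none) l'.length = x'
      · exact (X.state_eq_of_mem_pathEvent (hsub _ hl')).trans hx
      · simp only [hB] at hl'
        rw [if_neg hx] at hl'
        exact absurd hl' (notMem_empty ω)
  rw [h1, measure_iUnion (fun l l' h => (X.disjoint_pathEvent t h).mono (hsub l) (hsub l')) hBm]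
  refine tsum_congr fun l => ?_
  simp only [hB]
  split_ifs
  · exact X.prob_pathEvent ENNReal.ofReal_ne_top l
  · exact measure_empty

end ChemicalProcess

namespace ReactionNetwork

variable {N M : ℕ} (net : ReactionNetwork N M)

theorem measurable_pathProb (l : List (Option (Fin M))) (x : Fin N → ℤ) :
    Measurable (net.pathProb l x) := by
  induction l generalizing x with
  | nil =>
    have : Antitone (net.pathProb [] x) := fun s t h => measure_mono (Ioi_subset_Ioi h)
    exact this.measurable
  | cons o l ih =>
    simp only [pathProb, ← lintegral_indicator measurableSet_Iic]
    refine Measurable.const_mul (Measurable.lintegral_prod_right'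
      (f := fun q : ℝ≥0∞ × ℝ≥0∞ => (Iic q.1).indicator
        (fun y => net.pathProb l (x + o.elim 0 net.ν) (q.1 - y)) q.2) ?_) _
    have : (fun q : ℝ≥0∞ × ℝ≥0∞ => (Iic q.1).indicator
        (fun y => net.pathProb l (x + o.elim 0 net.ν) (q.1 - y)) q.2) =
        {q : ℝ≥0∞ × ℝ≥0∞ | q.2 ≤ q.1}.indicator
          (fun q => net.pathProb l (x + o.elim 0 net.ν) (q.1 - q.2)) := by
      ext q
      simp only [indicator, mem_Iic, mem_ofPred_eq]
    rw [this]
    exact ((ih _).comp (measurable_fst.sub measurable_snd)).indicator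
      (measurableSet_le measurable_snd measurable_fst)

/-- The probability of reaching `x'` from `x` in the time `t` by finitely many reactions. -/
def reachProb (x' x : Fin N → ℤ) (t : ℝ≥0∞) : ℝ≥0∞ :=
  ∑' l : List (Option (Fin M)),
    if net.chain x (fun i => l.getD i none) l.length = x' then net.pathProb l x t else 0

theorem measurable_reachProb (x' x : Fin N → ℤ) : Measurable (net.reachProb x' x) := by
  refine Measurable.tsum fun l => ?_
  split_ifs
  · exact net.measurable_pathProb l x
  · exact measurable_const

theorem _root_.ENNReal.tsum_list {α : Type*} (f : List α → ℝ≥0∞) :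
    ∑' l, f l = f [] + ∑' o, ∑' l, f (o :: l) := by
  let e : Unit ⊕ (α × List α) ≃ List α :=
    { toFun := Sum.elim (fun _ => []) fun q => q.1 :: q.2
      invFun := fun l => match l with
        | [] => Sum.inl ()
        | o :: l => Sum.inr (o, l)
      left_inv := by rintro (_ | _) <;> rfl
      right_inv := by rintro (_ | _) <;> rfl }
  rw [← e.tsum_eq, Summable.tsum_sum ENNReal.summable ENNReal.summable, ENNReal.tsum_prod']
  simp [e]

theorem reachProb_eq (x' x : Fin N → ℤ) (t : ℝ≥0∞) :
    net.reachProb x' x t = (if x = x' then waitingLaw (net.a₀ x) (Ioi t) else 0) +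
      ∑ o, ENNReal.ofReal (net.jumpProb x o) *
        ∫⁻ y in Iic t, net.reachProb x' (x + o.elim 0 net.ν) (t - y) ∂waitingLaw (net.a₀ x) := by
  rw [reachProb, ENNReal.tsum_list, tsum_fintype]
  congr 1
  · simp [chain, pathProb]
  · refine Finset.sum_congr rfl fun o _ => ?_
    simp only [reachProb]
    rw [lintegral_tsum, ← ENNReal.tsum_mul_left]
    · refine tsum_congr fun l => ?_
      rw [List.length_cons, chain_cons]
      split_ifs
      · rfl
      · simp
    · intro l
      split_ifs
      · exact ((net.measurable_pathProb l _).comp (measurable_const.sub measurable_id)).aemeasurable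
      · exact aemeasurable_const

theorem lintegral_Iic_waitingLaw {r : ℝ} (hr : 0 < r) {u : ℝ≥0∞ → ℝ≥0∞} (hu : Measurable u)
    (hu1 : ∀ t : ℝ, u (ENNReal.ofReal t) ≤ 1) {t : ℝ} (ht : 0 ≤ t) :
    ∫⁻ y in Iic (ENNReal.ofReal t), u (ENNReal.ofReal t - y) ∂waitingLaw r =
      ENNReal.ofReal (r * ∫ s in (0 : ℝ)..t,
        Real.exp (-(r * s)) * (u (ENNReal.ofReal (t - s))).toReal) := by
  have hum : Measurable fun s : ℝ => (u (ENNReal.ofReal (t - s))).toReal :=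
    (hu.comp (ENNReal.measurable_ofReal.comp (measurable_const.sub measurable_id))).ennreal_toReal
  have hle : ∀ s : ℝ, (u (ENNReal.ofReal (t - s))).toReal ≤ 1 := fun s =>
    ENNReal.toReal_le_of_le_ofReal zero_le_one (by simpa using hu1 (t - s))
  have hut : Measurable fun y => u (ENNReal.ofReal t - y) :=
    hu.comp (measurable_const.sub measurable_id)
  rw [← lintegral_indicator measurableSet_Iic, lintegral_waitingLaw hr
    (hut.indicator measurableSet_Iic), ← intervalIntegral.integral_const_mul, intervalIntegral.integral_of_le ht,
    ← integral_Icc_eq_integral_Ioc, ofReal_integral_eq_lintegral_ofReal]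
  · rw [← lintegral_indicator measurableSet_Ici, ← lintegral_indicator measurableSet_Icc]
    refine lintegral_congr fun s => ?_
    by_cases h0 : 0 ≤ s
    · rw [indicator_of_mem (mem_Ici.2 h0)]
      by_cases hst : s ≤ t
      · rw [indicator_of_mem (mem_Icc.2 ⟨h0, hst⟩),
          indicator_of_mem (mem_Iic.2 (ENNReal.ofReal_le_ofReal hst)),
          ← ENNReal.ofReal_sub _ h0, ← mul_assoc,
          ENNReal.ofReal_mul (p := r * Real.exp (-(r * s))) (by positivity),
          ENNReal.ofReal_toReal ((hu1 _).trans_lt ENNReal.one_lt_top).ne]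
      · have : ENNReal.ofReal s ∉ Iic (ENNReal.ofReal t) := fun h =>
          hst ((ENNReal.ofReal_le_ofReal_iff ht).1 h)
        rw [indicator_of_notMem this, indicator_of_notMem fun h => hst h.2, mul_zero]
    · rw [indicator_of_notMem (by simpa using h0), indicator_of_notMem fun h => h0 h.1]
  · refine Measure.integrableOn_of_bounded (M := r) (by simp) ?_ ?_
    · exact (Measurable.const_mul (Measurable.mul (by fun_prop) hum) r).aestronglyMeasurable
    · refine (ae_restrict_iff' measurableSet_Icc).2 (Filter.Eventually.of_forall fun s hs => ?_)
      rw [Real.norm_of_nonneg (by positivity)]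
      have h1 : Real.exp (-(r * s)) ≤ 1 := by
        simpa using mul_nonneg hr.le hs.1
      calc r * (Real.exp (-(r * s)) * _) ≤ r * (1 * 1) := by
            gcongr
            exact hle s
        _ = r := by ring
  · exact Filter.Eventually.of_forall fun s => by positivity

theorem toReal_reachProb (x' : Fin N → ℤ)
    (h1 : ∀ x (t : ℝ), net.reachProb x' x (ENNReal.ofReal t) ≤ 1) (x : Fin N → ℤ) {t : ℝ}
    (ht : 0 ≤ t) :
    (net.reachProb x' x (ENNReal.ofReal t)).toReal =
      Real.exp (-(net.a₀ x * t)) * (if x = x' then 1 else 0) +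
        ∑ j, net.a j x * ∫ s in (0 : ℝ)..t, Real.exp (-(net.a₀ x * s)) *
          (net.reachProb x' (x + net.ν j) (ENNReal.ofReal (t - s))).toReal := by
  have hI : ∀ z, 0 ≤ ∫ s in (0 : ℝ)..t, Real.exp (-(net.a₀ x * s)) *
          (net.reachProb x' z (ENNReal.ofReal (t - s))).toReal := fun z =>
    intervalIntegral.integral_nonneg ht fun s _ => by positivity
  have hterm : ∀ j, ENNReal.ofReal (net.jumpProb x (some j)) *
      ∫⁻ y in Iic (ENNReal.ofReal t), net.reachProb x' (x + net.ν j) (ENNReal.ofReal t - y)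
        ∂waitingLaw (net.a₀ x) = ENNReal.ofReal (net.a j x *
          ∫ s in (0 : ℝ)..t, Real.exp (-(net.a₀ x * s)) *
            (net.reachProb x' (x + net.ν j) (ENNReal.ofReal (t - s))).toReal) := by
    intro j
    rcases (net.a₀_nonneg x).eq_or_lt with h0 | h0
    · have haj : net.a j x = 0 :=
        (Finset.sum_eq_zero_iff_of_nonneg fun j _ => net.a_nonneg j x).1 h0.symm j
          (Finset.mem_univ j)
      simp [jumpProb, ← h0, haj]
    · rw [lintegral_Iic_waitingLaw h0 (net.measurable_reachProb x' _) (h1 _) ht,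
        ← ENNReal.ofReal_mul (net.jumpProb_nonneg x _), ← mul_assoc]
      simp only [jumpProb, if_neg h0.ne']
      rw [div_mul_cancel₀ _ h0.ne']
  have hnone : ENNReal.ofReal (net.jumpProb x none) *
      ∫⁻ y in Iic (ENNReal.ofReal t), net.reachProb x' (x + (none : Option (Fin M)).elim 0 net.ν)
        (ENNReal.ofReal t - y) ∂waitingLaw (net.a₀ x) = 0 := by
    by_cases h0 : net.a₀ x = 0
    · rw [h0, waitingLaw_zero, Measure.restrict_eq_zero.2 (by simp [Measure.dirac_apply' _ measurableSet_Iic])]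
      simp
    · simp [jumpProb, h0]
  have hnn : 0 ≤ ∑ j, net.a j x * ∫ s in (0 : ℝ)..t, Real.exp (-(net.a₀ x * s)) *
          (net.reachProb x' (x + net.ν j) (ENNReal.ofReal (t - s))).toReal :=
    Finset.sum_nonneg fun j _ => mul_nonneg (net.a_nonneg j x) (hI _)
  rw [reachProb_eq, Fintype.sum_option, hnone, zero_add]
  simp only [Option.elim_some]
  rw [Finset.sum_congr rfl fun j _ => hterm j,
    ← ENNReal.ofReal_sum_of_nonneg fun j _ => mul_nonneg (net.a_nonneg j x) (hI _),
    ENNReal.toReal_add (by split_ifs <;> simp) ENNReal.ofReal_ne_top, ENNReal.toReal_ofReal hnn]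
  congr 1
  split_ifs
  · rw [waitingLaw_Ioi (net.a₀_nonneg x) ht, ENNReal.toReal_ofReal (Real.exp_pos _).le, mul_one]
  · simp

/-- The first-step integral equation implies the backward equation. -/
theorem backward_of_integral_eq {p : ℝ → (Fin N → ℤ) → ℝ} {g : (Fin N → ℤ) → ℝ}
    (hm : ∀ x, Measurable fun t => p t x) (hb : ∀ t x, |p t x| ≤ 1)
    (hneg : ∀ t x, p (max t 0) x = p t x)
    (h : ∀ x t, 0 ≤ t → p t x = Real.exp (-(net.a₀ x * t)) * g x +
      ∑ j, net.a j x * ∫ s in (0 : ℝ)..t, Real.exp (-(net.a₀ x * s)) * p (t - s) (x + net.ν j))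
    (x : Fin N → ℤ) (t : ℝ) (ht : t ∈ Ici (0 : ℝ)) :
    HasDerivWithinAt (fun t => p t x) (net.generator (p t) x) (Ici 0) t := by
  set R : (Fin N → ℤ) → ℝ → ℝ := fun x t => Real.exp (-(net.a₀ x * t)) * (g x +
    ∑ j, net.a j x * ∫ s in (0 : ℝ)..t, Real.exp (net.a₀ x * s) * p s (x + net.ν j)) with hR
  have hpR : ∀ x t, 0 ≤ t → p t x = R x t := by
    intro x t ht
    rw [h x t ht, hR]
    simp only [mul_add, Finset.mul_sum]
    congr 1
    refine Finset.sum_congr rfl fun j _ => ?_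
    have h2 := intervalIntegral.integral_comp_sub_left (a := 0) (b := t) (E := ℝ)
      (fun s : ℝ => Real.exp (-(net.a₀ x * (t - s))) * p s (x + net.ν j)) t
    simp only [sub_sub_cancel, sub_self, sub_zero] at h2
    have h3 : ∀ s, Real.exp (-(net.a₀ x * (t - s))) * p s (x + net.ν j) =
        Real.exp (-(net.a₀ x * t)) * (Real.exp (net.a₀ x * s) * p s (x + net.ν j)) := fun s => by
      rw [← mul_assoc, ← Real.exp_add]
      ring_nf
    simp only [h3] at h2
    rw [h2, intervalIntegral.integral_const_mul, mul_left_comm]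
  have hint : ∀ x z a b, IntervalIntegrable (fun s => Real.exp (net.a₀ x * s) * p s z)
      volume a b := by
    intro x z a b
    refine IntervalIntegrable.continuousOn_mul ?_ (by fun_prop)
    refine (intervalIntegrable_const (c := (1 : ℝ))).mono_fun (hm z).aestronglyMeasurable ?_
    exact Filter.Eventually.of_forall fun s => by simpa using hb s z
  have hRc : ∀ x, Continuous (R x) := by
    intro x
    refine Continuous.mul (by fun_prop) (continuous_const.add
      (continuous_finsetSum _ fun j _ => continuous_const.mul ?_))
    exact intervalIntegral.continuous_primitive (hint x _) 0
  have hpc : ∀ x, Continuous fun t => p t x := by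
    intro x
    have : (fun t => p t x) = fun t => R x (max t 0) := by
      ext t; rw [← hneg, hpR x _ (le_max_right t 0)]
    rw [this]
    exact (hRc x).comp (by fun_prop)
  have hd : HasDerivAt (R x) (net.generator (p t) x) t := by
    have h1 : HasDerivAt (fun t => Real.exp (-(net.a₀ x * t)))
        (Real.exp (-(net.a₀ x * t)) * (-(net.a₀ x * 1))) t :=
      ((hasDerivAt_id t).const_mul _).neg.exp
    have h2 : HasDerivAt (fun t => g x + ∑ j, net.a j x *
        ∫ s in (0 : ℝ)..t, Real.exp (net.a₀ x * s) * p s (x + net.ν j))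
        (∑ j, net.a j x * (Real.exp (net.a₀ x * t) * p t (x + net.ν j))) t := by
      refine (HasDerivAt.fun_sum fun j _ => HasDerivAt.const_mul _ ?_).const_add _
      have hc : Continuous fun s => Real.exp (net.a₀ x * s) * p s (x + net.ν j) :=
        Continuous.mul (by fun_prop) (hpc _)
      exact (hc.integral_hasStrictDerivAt 0 t).hasDerivAt
    refine (h1.mul h2).congr_deriv ?_
    have hx := hpR x t ht
    have he : Real.exp (-(net.a₀ x * t)) * Real.exp (net.a₀ x * t) = 1 := by
      rw [← Real.exp_add]; simp
    have e1 : Real.exp (-(net.a₀ x * t)) * (-(net.a₀ x * 1)) * (g x + ∑ j, net.a j x *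
        ∫ s in (0 : ℝ)..t, Real.exp (net.a₀ x * s) * p s (x + net.ν j)) =
        -(net.a₀ x * p t x) := by
      rw [hx, hR]; ring
    have e2 : ∑ j, net.a j x * p t x = net.a₀ x * p t x := by rw [a₀, Finset.sum_mul]
    rw [e1, Finset.mul_sum, generator]
    simp only [mul_sub, Finset.sum_sub_distrib, e2]
    rw [sub_eq_neg_add]
    congr 1
    refine Finset.sum_congr rfl fun j _ => ?_
    linear_combination (net.a j x * p t (x + net.ν j)) * he
  exact hd.hasDerivWithinAt.congr (fun s hs => hpR x s hs) (hpR x t ht)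

end ReactionNetwork

section Transition

variable {N M : ℕ} {net : ReactionNetwork N M} {Ω : (Fin N → ℤ) → Type*}
  [∀ x, MeasurableSpace (Ω x)] (X : ∀ x, ChemicalProcess net x (Ω x))

theorem transProb_eq (t : ℝ) (x x' : Fin N → ℤ) :
    transProb X t x x' = (net.reachProb x' x (ENNReal.ofReal t)).toReal :=
  congrArg ENNReal.toReal ((X x).prob_state_eq t x')

theorem transProb_backward (x' x : Fin N → ℤ) (t : ℝ) (ht : t ∈ Ici (0 : ℝ)) :
    HasDerivWithinAt (fun t => transProb X t x x')
      (net.generator (fun y => transProb X t y x') x) (Ici 0) t := by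
  have h1 : ∀ x (t : ℝ), net.reachProb x' x (ENNReal.ofReal t) ≤ 1 := fun x t => by
    have := (X x).isProb
    exact ((X x).prob_state_eq t x').symm.le.trans prob_le_one
  refine net.backward_of_integral_eq (p := fun t x => transProb X t x x')
    (g := fun x => if x = x' then 1 else 0) (fun x => ?_) (fun t x => ?_) (fun t x => ?_)
    (fun x t ht => ?_) x t ht
  · simp only [transProb_eq]
    exact ((net.measurable_reachProb x' x).comp ENNReal.measurable_ofReal).ennreal_toReal
  · have := (X x).isProb
    exact (abs_of_nonneg measureReal_nonneg).trans_le measureReal_le_one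
  · simp only [transProb_eq, ENNReal.ofReal_max, ENNReal.ofReal_zero, max_eq_left zero_le]
  · simp only [transProb_eq]
    exact net.toReal_reachProb x' h1 x ht

theorem transProb_zero (x x' : Fin N → ℤ) : transProb X 0 x x' = if x = x' then 1 else 0 := by
  have h1 : ∀ x (t : ℝ), net.reachProb x' x (ENNReal.ofReal t) ≤ 1 := fun x t => by
    have := (X x).isProb
    exact ((X x).prob_state_eq t x').symm.le.trans prob_le_one
  rw [transProb_eq, net.toReal_reachProb x' h1 x le_rfl]
  simp

end Transition

end

theorem mainTheorem8 {N M : ℕ} (net : ReactionNetwork N M)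
    {Ω : (Fin N → ℤ) → Type*} [∀ x, MeasurableSpace (Ω x)]
    (X : ∀ x, ChemicalProcess net x (Ω x))
    (L : TauLeapMethod N M)
    (nrmN : Seminorm ℝ (Fin N → ℝ)) (hN : ∀ v, nrmN v = 0 → v = 0)
    (nrmM : Seminorm ℝ (Fin M → ℝ)) (hM : ∀ v, nrmM v = 0 → v = 0)
    (q : ℕ) (δ : ℝ) (hδ : 0 < δ)
    (hbounds : DerivBounds nrmN nrmM q δ L.φt)
    (hgrowth : ∃ s : ℕ, ∀ j, PolyGrowth nrmN s (net.a j))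
    (hcons : ∀ x k, ∀ i, 1 ≤ i → i ≤ q →
      iteratedDerivWithin i (fun τ => L.φt τ x k) (Icc 0 δ) 0 = matPow (net.Qtilde x) i 0 k) :
    PointwiseConsistent q δ (L.φ net) (transProb X) := by
  intro x x'
  obtain ⟨μ, hμ, hsum⟩ := hbounds.bound
  obtain ⟨hφ, hφd⟩ := contDiffOn_tsum_Icc hδ (n := q + 1)
    (f := fun (k : net.countSet x x') τ => L.φt τ x k) (u := fun i k => μ k i x)
    (fun k => hbounds.contDiff x k)
    (fun i hi => by
      obtain ⟨_, _, _, h⟩ := hsum 0 i hi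
      have h' := (h x).1
      simp only [pow_zero, one_mul] at h'
      exact h'.subtype _)
    (fun k i hi t ht => hμ k i hi x t ht)
  obtain ⟨hP, hPd⟩ := net.contDiffOn_of_backward (p := fun t y => transProb X t y x')
    (transProb_backward X x') x
  refine ⟨hφ, hP, fun i hi1 hiq => ?_⟩
  rw [hPd i 0 (mem_Ici.2 le_rfl)]
  simp only [transProb_zero]
  rw [← net.tsum_countSet_matPow x x' i]
  refine (hφd i (by omega) 0 (left_mem_Icc.2 hδ.le)).trans ?_
  exact tsum_congr fun k => hcons x k i hi1 hiq
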